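/- Let $\mathbf{k}$ be a field of characteristic $0$ and let $\mathbf{k}[\varepsilon]=\mathbf{k}\oplus\mathbf{k}\varepsilon$ with $\varepsilon$ odd and $\varepsilon^2=0$. Let $(A,\zeta)$ be a combinatorial Hopf superalgebra over $\mathbf{k}$: a connected graded Hopf superalgebra $A=\bigoplus_{k\ge 0}A^k=\bigoplus_{k\ge0}(A^k_{\overline 0}\oplus A^k_{\overline 1})$, $A^0=\mathbf{k}$, with an even superalgebra morphism $\zeta\colon A\to\mathbf{k}[\varepsilon]$. A dotted composition is a finite sequence $\alpha=(\alpha_1,\dots,\alpha_l)$ of entries in $\{1,2,3,\dots\}\cup\{\dot 0,\dot 1,\dot 2,\dots\}$. Put $\eta_i=1$ if $\alpha_i$ is dotted and $\eta_i=0$ otherwise, and write $|\alpha_i|$ for the number $\alpha_i$ without its dot. We call $\alpha$ a dotted composition of $k$ if $\sum_{i}(|\alpha_i|+\eta_i)=k$. Let $\mathrm{sQSym}$ be the space of quasi-symmetric functions in superspace, i.e. of the formal power series of finite degree in even variables $x_1,x_2,\dots$ and odd variables $\theta_1,\theta_2,\dots$ in which, for each dotted composition $\alpha$, all monomials $\theta_{i_1}^{\eta_1}\cdots\theta_{i_l}^{\eta_l}x_{i_1}^{|\alpha_1|}\cdots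 x_{i_l}^{|\alpha_l|}$ with $i_1<\dots<i_l$ have the same coefficient. It has the basis $$M_\alpha=\sum_{i_1<\dots<i_l}\theta_{i_1}^{\eta_1}\cdots\theta_{i_l}^{\eta_l}x_{i_1}^{|\alpha_1|}\cdots x_{i_l}^{|\alpha_l|},$$ and it is a Hopf superalgebra with the product of power series, the comultiplication $\Delta(M_\alpha)=\sum_{j=0}^{l}M_{(\alpha_1,\dots,\alpha_j)}\otimes M_{(\alpha_{j+1},\dots,\alpha_l)}$, the constant term as counit, the $\mathbb{N}$-grading by the degree in all the variables $x_i,\theta_i$, and the parity given by the degree in the $\theta_i$ modulo $2$. Let $\zeta_Q\colon\mathrm{sQSym}\to\mathbf{k}[\varepsilon]$ be the specialization $x_1=1$, $\theta_1=\varepsilon$, $x_i=\theta_i=0$ for $i\ge2$. Let $\Psi\colon A\to\mathrm{sQSym}$ be the universal morphism, i.e. the graded even morphism of Hopf superalgebras with $\zeta_Q\circ\Psi=\zeta$. Then, for every $k\ge0$ and every $a\in A^k$, $$\Psi(a)=\sum_{\alpha}\zeta_\alpha(a)\,M_\alpha,$$ where $\alpha$ runs over the dotted compositions of $k$, and for $\alpha=(\alpha_1,\dots,\alpha_l)$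 the functional $\zeta_\alpha$ is the composite $$\zeta_\alpha\colon A^k\xrightarrow{\ \Delta^{(l-1)}\ }A^{\otimes l}\xrightarrow{\ \pi_\alpha\ }A^{|\alpha_1|+\eta_1}_{\overline{\eta_1}}\otimes\cdots\otimes A^{|\alpha_l|+\eta_l}_{\overline{\eta_l}}\xrightarrow{\ \zeta^{\otimes l}\ }\mathbf{k}\varepsilon^{\eta_1}\otimes\cdots\otimes\mathbf{k}\varepsilon^{\eta_l}\cong\mathbf{k}.$$ Here $\Delta^{(l-1)}$ is the iterated comultiplication (the counit for $l=0$, the identity for $l=1$), $\pi_\alpha$ is the natural projection, and the last isomorphism sends $\varepsilon^{\eta_1}\otimes\cdots\otimes\varepsilon^{\eta_l}$ to $1$. -/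

import Mathlib

open scoped TensorProduct

noncomputable section

namespace SuperQSym

/-! ### Dotted compositions -/

/-- An entry of a dotted composition: an element of `{1, 2, 3, …} ∪ {0̇, 1̇, 2̇, …}`. -/
inductive DottedPart where
  | plain (n : ℕ+)
  | dotted (n : ℕ)

namespace DottedPart

/-- The underlying number; the dot is forgotten. -/
def val : DottedPart → ℕ
  | plain n => n
  | dotted n => n

/-- `1` if the entry is dotted, `0` otherwise. -/
def eta : DottedPart → ℕ
  | plain _ => 0
  | dotted _ => 1

/-- The contribution of an entry to the `ℕ`-degree: `n` for `n`, and `n + 1` for `ṅ`. -/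
def degree (p : DottedPart) : ℕ := p.val + p.eta

end DottedPart

/-- A dotted composition is a finite sequence of entries. -/
abbrev DottedComposition : Type := List DottedPart

/-- The degree of a dotted composition: its total degree plus its fermionic degree. -/
def compDegree (α : DottedComposition) : ℕ := (α.map DottedPart.degree).sum

theorem DottedPart.one_le_degree (p : DottedPart) : 1 ≤ p.degree := by
  cases p with
  | plain n => exact n.2
  | dotted n => exact Nat.le_add_left 1 n

theorem DottedPart.finite_degree_le (N : ℕ) : {p : DottedPart | p.degree ≤ N}.Finite := by
  have h : {p : DottedPart | p.degree ≤ N} ⊆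
      ((fun n : ℕ => DottedPart.plain n.toPNat') '' Set.Iic N) ∪
        (DottedPart.dotted '' Set.Iic N) := by
    intro p hp
    cases p with
    | plain n => exact Or.inl ⟨n, hp, by simp⟩
    | dotted n => exact Or.inr ⟨n, le_trans (Nat.le_succ n) hp, rfl⟩
  exact (((Set.finite_Iic N).image _).union ((Set.finite_Iic N).image _)).subset h

theorem finite_compDegree_le (N : ℕ) : {α : DottedComposition | compDegree α ≤ N}.Finite := by
  induction N with
  | zero =>
    refine (Set.finite_singleton ([] : DottedComposition)).subset ?_
    intro α hα
    cases α with
    | nil => rfl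
    | cons p α =>
      have := p.one_le_degree
      simp [compDegree] at hα
      omega
  | succ N ih =>
    have h : {α : DottedComposition | compDegree α ≤ N + 1} ⊆
        {[]} ∪ Set.image2 List.cons {p : DottedPart | p.degree ≤ N + 1}
          {α : DottedComposition | compDegree α ≤ N} := by
      intro α hα
      cases α with
      | nil => exact Or.inl rfl
      | cons p α =>
        have := p.one_le_degree
        simp [compDegree] at hα
        refine Or.inr ⟨p, ?_, α, ?_, rfl⟩
        · simp; omega
        · simp [compDegree]; omega
    exact ((Set.finite_singleton _).union
      ((DottedPart.finite_degree_le _).image2 _ ih)).subset h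

/-- The finite set of dotted compositions of `k`, i.e. of degree `k`. -/
def dottedCompositions (k : ℕ) : Finset DottedComposition :=
  ((finite_compDegree_le k).subset
    (fun _ h => le_of_eq h : {α | compDegree α = k} ⊆ {α | compDegree α ≤ k})).toFinset

theorem mem_dottedCompositions {k : ℕ} {α : DottedComposition} :
    α ∈ dottedCompositions k ↔ compDegree α = k := by
  simp [dottedCompositions]

/-! ### Power series in infinitely many supervariables -/

/-- The pair `(S, e)` stands for the monomial `θ_{s₁} ⋯ θ_{s_m} · ∏ x_i ^ e i` in the even
variables `x_i` and the odd variables `θ_i`, where `S = {s₁ < ⋯ < s_m}`.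
The variables are indexed by `0, 1, 2, …`. -/
abbrev SuperMonomial : Type := Finset ℕ × (ℕ →₀ ℕ)

/-- The degree of a monomial in all variables `x` and `θ` together. -/
def SuperMonomial.degree (m : SuperMonomial) : ℕ := m.2.degree + m.1.card

/-- Formal power series in the supervariables `(x; θ)`, as families of coefficients. -/
def SuperSeries (k : Type*) : Type _ := SuperMonomial → k

set_option linter.unusedSectionVars false

variable {k : Type*} [Field k]

instance : AddCommGroup (SuperSeries k) := inferInstanceAs (AddCommGroup (SuperMonomial → k))

instance : Module k (SuperSeries k) := inferInstanceAs (Module k (SuperMonomial → k))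

/-- For disjoint `T` and `U` one has `θ_T θ_U = thetaSign T U • θ_{T ∪ U}`; the sign counts
the pairs of variables that have to be interchanged. -/
def thetaSign (T U : Finset ℕ) : ℤ := (-1) ^ ((T ×ˢ U).filter fun p => p.2 < p.1).card

/-- The product of series: the `x_i` commute with everything, the `θ_i` anticommute with each
other and have square zero. -/
instance : Mul (SuperSeries k) where
  mul f g := fun m => ∑ T ∈ m.1.powerset, ∑ d ∈ Finset.HasAntidiagonal.antidiagonal m.2,
    (thetaSign T (m.1 \ T) : k) * f (T, d.1) * g (m.1 \ T, d.2)

instance : One (SuperSeries k) where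
  one := fun m => if m = (∅, 0) then 1 else 0

/-! ### Quasi-symmetric functions in superspace -/

/-- The monomial `θ_{i₁}^{η₁} ⋯ θ_{i_l}^{η_l} x_{i₁}^{α₁} ⋯ x_{i_l}^{α_l}` for a dotted
composition `α` and indices `i₁ < ⋯ < i_l`. -/
def mon (α : DottedComposition) (i : Fin α.length ↪o ℕ) : SuperMonomial :=
  ((Finset.univ.filter fun t => (α.get t).eta = 1).map i.toEmbedding,
    ∑ t, Finsupp.single (i t) (α.get t).val)

/-- `f` involves only monomials of degree at most some `N`. -/
def FiniteDegree (f : SuperSeries k) : Prop := ∃ N, ∀ m : SuperMonomial, f m ≠ 0 → m.degree ≤ N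

/-- For every dotted composition `α`, all monomials attached to `α` have the same coefficient. -/
def IsQuasiSymmetric (f : SuperSeries k) : Prop :=
  ∀ (α : DottedComposition) (i j : Fin α.length ↪o ℕ), f (mon α i) = f (mon α j)

variable (k) in
/-- The space of quasi-symmetric functions in superspace. -/
def sQSym : Submodule k (SuperSeries k) where
  carrier := {f | FiniteDegree f ∧ IsQuasiSymmetric f}
  zero_mem' := ⟨⟨0, fun _ h => absurd rfl h⟩, fun _ _ _ => rfl⟩
  add_mem' := by
    rintro f g ⟨⟨N, hN⟩, hf⟩ ⟨⟨N', hN'⟩, hg⟩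
    refine ⟨⟨max N N', fun m hm => ?_⟩, fun α i j => congrArg₂ (· + ·) (hf α i j) (hg α i j)⟩
    by_cases h : f m = 0
    · refine le_max_of_le_right (hN' m fun h' => hm ?_)
      change f m + g m = 0
      rw [h, h', add_zero]
    · exact le_max_of_le_left (hN m h)
  smul_mem' := by
    rintro c f ⟨⟨N, hN⟩, hf⟩
    refine ⟨⟨N, fun m hm => hN m fun h => hm ?_⟩, fun α i j => congrArg (c * ·) (hf α i j)⟩
    change c * f m = 0
    rw [h, mul_zero]

/-- The dotted composition read off from the exponents of a monomial. -/
def shape {I : Type*} [LinearOrder I] (T : Finset I) (d : I →₀ ℕ) : DottedComposition :=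
  ((T ∪ d.support).sort (· ≤ ·)).map fun n =>
    if n ∈ T then DottedPart.dotted (d n) else DottedPart.plain (d n).toPNat'

theorem sort_map {I : Type*} [LinearOrder I] (s : Finset I) (i : I ↪o ℕ) :
    (s.map i.toEmbedding).sort (· ≤ ·) = (s.sort (· ≤ ·)).map i :=
  (Finset.map_sort _ _ _ _ fun _ _ _ _ => i.le_iff_le.symm).symm

theorem shape_map {I : Type*} [LinearOrder I] (i : I ↪o ℕ) (T : Finset I) (d : I →₀ ℕ) :
    shape (T.map i.toEmbedding) (d.embDomain i.toEmbedding) = shape T d := by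
  have h : T.map i.toEmbedding ∪ (d.embDomain i.toEmbedding).support =
      (T ∪ d.support).map i.toEmbedding := by
    rw [Finsupp.support_embDomain, Finset.map_union]
  rw [shape, h, sort_map, List.map_map, shape]
  refine List.map_congr_left fun n _ => ?_
  have h1 : d.embDomain i.toEmbedding (i n) = d n := Finsupp.embDomain_apply_self _ _ _
  have h2 : i n ∈ T.map i.toEmbedding ↔ n ∈ T := Finset.mem_map' i.toEmbedding
  simp only [Function.comp, h1, h2]

/-- The exponents of `θ` in the monomials attached to `α`. -/
def thetaExp (α : DottedComposition) : Finset (Fin α.length) :=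
  Finset.univ.filter fun t => (α.get t).eta = 1

/-- The exponents of `x` in the monomials attached to `α`. -/
def xExp (α : DottedComposition) : Fin α.length →₀ ℕ :=
  Finsupp.equivFunOnFinite.symm fun t => (α.get t).val

theorem mon_eq (α : DottedComposition) (i : Fin α.length ↪o ℕ) :
    mon α i = ((thetaExp α).map i.toEmbedding, (xExp α).embDomain i.toEmbedding) := by
  refine Prod.ext rfl ?_
  have h : xExp α = ∑ t, Finsupp.single t (α.get t).val :=
    (Finsupp.univ_sum_single (xExp α)).symm
  simp only [mon, h, Finsupp.embDomain_eq_mapDomain, Finsupp.mapDomain_finsetSum,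
    Finsupp.mapDomain_single]
  rfl

theorem shape_exp (α : DottedComposition) : shape (thetaExp α) (xExp α) = α := by
  have h : thetaExp α ∪ (xExp α).support = Finset.univ := by
    refine Finset.eq_univ_iff_forall.2 fun t => ?_
    have := (α.get t).one_le_degree
    rw [DottedPart.degree] at this
    simp only [thetaExp, xExp, Finset.mem_union, Finset.mem_filter, Finset.mem_univ, true_and,
      Finsupp.mem_support_iff, Finsupp.equivFunOnFinite_symm_apply_apply]
    cases h : α.get t with
    | plain n => exact Or.inr n.ne_zero
    | dotted n => exact Or.inl rfl
  rw [shape, h, Fin.sort_univ]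
  conv_rhs => rw [← List.map_get_finRange α]
  refine List.map_congr_left fun t _ => ?_
  simp only [thetaExp, xExp, Finset.mem_filter, Finset.mem_univ, true_and,
    Finsupp.equivFunOnFinite_symm_apply_apply]
  cases α.get t with
  | plain n => simp [DottedPart.eta, DottedPart.val]
  | dotted n => simp [DottedPart.eta, DottedPart.val]

theorem shape_mon (α : DottedComposition) (i : Fin α.length ↪o ℕ) :
    shape (mon α i).1 (mon α i).2 = α := by
  rw [mon_eq, shape_map, shape_exp]

theorem exists_mon_shape (m : SuperMonomial) :
    ∃ i : Fin (shape m.1 m.2).length ↪o ℕ, mon (shape m.1 m.2) i = m := by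
  obtain ⟨T, d⟩ := m
  have hl : (shape T d).length = (T ∪ d.support).card := by
    simp [shape]
  have hget : ∀ t : Fin (shape T d).length, (shape T d).get t =
      if (T ∪ d.support).orderEmbOfFin rfl (Fin.cast hl t) ∈ T then
        DottedPart.dotted (d ((T ∪ d.support).orderEmbOfFin rfl (Fin.cast hl t)))
      else DottedPart.plain (d ((T ∪ d.support).orderEmbOfFin rfl (Fin.cast hl t))).toPNat' := by
    intro t
    exact (List.getElem_map _).trans rfl
  let i : Fin (shape T d).length ↪o ℕ :=
    (Fin.castOrderIso hl).toOrderEmbedding.trans ((T ∪ d.support).orderEmbOfFin rfl)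
  have hi : ∀ t, (T ∪ d.support).orderEmbOfFin rfl (Fin.cast hl t) = i t := fun _ => rfl
  have hrange : ∀ n, n ∈ T ∪ d.support → ∃ t, i t = n := by
    intro n hn
    have : n ∈ Set.range ((T ∪ d.support).orderEmbOfFin rfl) := by
      rw [Finset.range_orderEmbOfFin]; exact hn
    obtain ⟨t, ht⟩ := this
    exact ⟨Fin.cast hl.symm t, ht⟩
  have hmem : ∀ t, i t ∈ T ∪ d.support :=
    fun t => Finset.orderEmbOfFin_mem (T ∪ d.support) rfl (Fin.cast hl t)
  simp only [hi] at hget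
  have hval : ∀ t, ((shape T d).get t).val = d (i t) := by
    intro t
    rw [hget]
    split_ifs with h
    · rfl
    · have : 0 < d (i t) := by
        have := hmem t
        simp only [Finset.mem_union, h, false_or, Finsupp.mem_support_iff] at this
        omega
      simp [DottedPart.val, this]
  refine ⟨i, Prod.ext ?_ ?_⟩
  · ext n
    simp only [mon, Finset.mem_map, Finset.mem_filter, Finset.mem_univ, true_and]
    constructor
    · rintro ⟨t, ht, rfl⟩
      rw [hget] at ht
      by_contra h
      have h' : i t ∉ T := h
      rw [if_neg h'] at ht
      exact absurd ht (by simp [DottedPart.eta])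
    · intro hn
      obtain ⟨t, rfl⟩ := hrange n (Finset.mem_union_left _ hn)
      exact ⟨t, by rw [hget, if_pos hn]; rfl, rfl⟩
  · rw [mon_eq]
    ext n
    by_cases hn : n ∈ Set.range i
    · obtain ⟨t, rfl⟩ := hn
      exact (Finsupp.embDomain_apply_self _ _ _).trans (hval t)
    · refine (Finsupp.embDomain_of_notMem_range _ _ _ hn).trans ?_
      by_contra h
      exact hn (hrange n (Finset.mem_union_right _ (Finsupp.mem_support_iff.2 (Ne.symm h))))

theorem degree_mon (α : DottedComposition) (i : Fin α.length ↪o ℕ) :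
    (mon α i).degree = compDegree α := by
  have h1 : (mon α i).2.degree = ∑ t, (α.get t).val := by
    simp [mon, map_sum, Finsupp.degree_single]
  have h2 : (mon α i).1.card = ∑ t, (α.get t).eta := by
    rw [mon, Finset.card_map, Finset.card_filter]
    refine Finset.sum_congr rfl fun t _ => ?_
    cases α.get t <;> rfl
  rw [SuperMonomial.degree, h1, h2, ← Finset.sum_add_distrib, compDegree]
  conv_rhs => rw [← List.map_get_finRange α]
  rw [List.map_map, ← List.ofFn_eq_map, List.sum_ofFn]
  rfl

/-- Quasi-symmetric series are constant on the monomials of a given shape. -/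
theorem IsQuasiSymmetric.eq_of_shape {f : SuperSeries k} (hf : IsQuasiSymmetric f)
    {m m' : SuperMonomial} (h : shape m.1 m.2 = shape m'.1 m'.2) : f m = f m' := by
  obtain ⟨i, hi⟩ := exists_mon_shape m
  obtain ⟨j, hj⟩ := exists_mon_shape m'
  rw [← hi, ← hj]
  generalize shape m'.1 m'.2 = β at *
  subst h
  exact hf _ i j

theorem isQuasiSymmetric_of_shape (c : DottedComposition → k) :
    IsQuasiSymmetric (fun m => c (shape m.1 m.2) : SuperSeries k) := by
  intro α i j
  simp only [shape_mon]

open Classical in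
/-- The series `∑_{i₁ < ⋯ < i_l} θ_{i₁}^{η₁} ⋯ θ_{i_l}^{η_l} x_{i₁}^{α₁} ⋯ x_{i_l}^{α_l}`.
Distinct index sequences give distinct monomials, so all coefficients are `0` or `1`. -/
def monomialSeries (α : DottedComposition) : SuperSeries k :=
  fun m => if ∃ i : Fin α.length ↪o ℕ, mon α i = m then 1 else 0

theorem exists_mon_iff (α : DottedComposition) (m : SuperMonomial) :
    (∃ i : Fin α.length ↪o ℕ, mon α i = m) ↔ shape m.1 m.2 = α := by
  constructor
  · rintro ⟨i, rfl⟩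
    exact shape_mon α i
  · rintro rfl
    exact exists_mon_shape m

variable (k) in
/-- The monomial quasi-symmetric function `M_α` in superspace. -/
def M (α : DottedComposition) : sQSym k :=
  ⟨monomialSeries α, by
    classical
    constructor
    · refine ⟨compDegree α, fun m hm => ?_⟩
      by_cases h : ∃ i : Fin α.length ↪o ℕ, mon α i = m
      · obtain ⟨i, rfl⟩ := h
        exact (degree_mon α i).le
      · exact absurd (if_neg h) hm
    · intro β i j
      simp only [monomialSeries, exists_mon_iff, shape_mon]⟩

/-- The common coefficient of the monomials attached to `α`. -/
def coeff (f : SuperSeries k) (α : DottedComposition) : k := f (mon α (Fin.valOrderEmb α.length))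

theorem finite_coeff (f : sQSym k) : (Function.support (coeff f.1)).Finite := by
  obtain ⟨N, hN⟩ := f.2.1
  refine (finite_compDegree_le N).subset fun α hα => ?_
  have := hN _ hα
  rwa [degree_mon] at this

variable (k) in
/-- The basis of `sQSym` formed by the monomial quasi-symmetric functions. -/
def basisM : Module.Basis DottedComposition k (sQSym k) :=
  Module.Basis.ofRepr
    { toFun := fun f => Finsupp.ofSupportFinite (coeff f.1) (finite_coeff f)
      invFun := fun c => ⟨fun m => c (shape m.1 m.2), by
        constructor
        · refine ⟨c.support.sup compDegree, fun m hm => ?_⟩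
          obtain ⟨i, hi⟩ := exists_mon_shape m
          have h := degree_mon _ i
          rw [hi] at h
          rw [h]
          exact Finset.le_sup (Finsupp.mem_support_iff.2 hm)
        · exact isQuasiSymmetric_of_shape c⟩
      map_add' := fun _ _ => Finsupp.ext fun _ => rfl
      map_smul' := fun _ _ => Finsupp.ext fun _ => rfl
      left_inv := fun f => Subtype.ext <| funext fun m =>
        f.2.2.eq_of_shape (shape_mon _ _)
      right_inv := fun c => Finsupp.ext fun α => congrArg c (shape_mon α _) }

theorem basisM_apply (α : DottedComposition) : basisM k α = M k α := by
  classical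
  rw [← Module.Basis.repr_symm_single_one]
  refine Subtype.ext <| funext fun m => ?_
  change Finsupp.single α (1 : k) (shape m.1 m.2) = monomialSeries α m
  simp only [monomialSeries, exists_mon_iff, Finsupp.single_apply, @eq_comm _ α]

theorem mul_apply (f g : SuperSeries k) (m : SuperMonomial) :
    (f * g) m = ∑ T ∈ m.1.powerset, ∑ d ∈ Finset.HasAntidiagonal.antidiagonal m.2,
      (thetaSign T (m.1 \ T) : k) * f (T, d.1) * g (m.1 \ T, d.2) := rfl

theorem thetaSign_map {n : ℕ} (i j : Fin n ↪o ℕ) (T U : Finset (Fin n)) :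
    thetaSign (T.map i.toEmbedding) (U.map i.toEmbedding) =
      thetaSign (T.map j.toEmbedding) (U.map j.toEmbedding) := by
  have h : ∀ i : Fin n ↪o ℕ, ((T.map i.toEmbedding ×ˢ U.map i.toEmbedding).filter
      fun p => p.2 < p.1).card = ((T ×ˢ U).filter fun p => p.2 < p.1).card := by
    intro i
    symm
    refine Finset.card_bij (fun p _ => (i p.1, i p.2)) ?_ ?_ ?_
    · intro p hp
      simpa using hp
    · intro p _ q _ h
      rw [Prod.mk.injEq] at h
      exact Prod.ext (i.injective h.1) (i.injective h.2)
    · rintro ⟨x, y⟩ hp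
      simp only [Finset.mem_filter, Finset.mem_product, Finset.mem_map] at hp
      obtain ⟨⟨⟨s, hs, rfl⟩, ⟨t, ht, rfl⟩⟩, h⟩ := hp
      exact ⟨(s, t), by simpa [hs, ht] using h, rfl⟩
  rw [thetaSign, thetaSign, h, h]

theorem mul_apply_map (f g : SuperSeries k) {n : ℕ} (i : Fin n ↪o ℕ) (S : Finset (Fin n))
    (e : Fin n →₀ ℕ) :
    (f * g) (S.map i.toEmbedding, e.embDomain i.toEmbedding) =
      ∑ T ∈ S.powerset, ∑ d ∈ Finset.HasAntidiagonal.antidiagonal e,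
        (thetaSign (T.map i.toEmbedding) ((S \ T).map i.toEmbedding) : k) *
          f (T.map i.toEmbedding, d.1.embDomain i.toEmbedding) *
          g ((S \ T).map i.toEmbedding, d.2.embDomain i.toEmbedding) := by
  rw [mul_apply]
  symm
  refine Finset.sum_bij (fun T _ => T.map i.toEmbedding) ?_ ?_ ?_ ?_
  · intro T hT
    rw [Finset.mem_powerset] at hT ⊢
    exact Finset.map_subset_map.2 hT
  · intro T _ T' _ h
    exact Finset.map_injective _ h
  · intro U hU
    obtain ⟨T, hT, rfl⟩ := Finset.subset_map_iff.1 (Finset.mem_powerset.1 hU)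
    exact ⟨T, Finset.mem_powerset.2 hT, rfl⟩
  · intro T _
    refine Finset.sum_bij (fun d _ => (d.1.embDomain i.toEmbedding,
      d.2.embDomain i.toEmbedding)) ?_ ?_ ?_ ?_
    · intro d hd
      rw [Finset.HasAntidiagonal.mem_antidiagonal] at hd ⊢
      simp only [← hd, Finsupp.embDomain_add]
    · intro d _ d' _ h
      rw [Prod.mk.injEq] at h
      exact Prod.ext (Finsupp.embDomain_injective _ h.1) (Finsupp.embDomain_injective _ h.2)
    · intro p hp
      rw [Finset.HasAntidiagonal.mem_antidiagonal] at hp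
      have hs : ∀ m, p.1 m + p.2 m ≠ 0 → m ∈ Set.range i.toEmbedding := by
        intro m hm
        by_contra h
        apply hm
        rw [← Finsupp.add_apply, hp]
        exact Finsupp.embDomain_of_notMem_range _ _ _ h
      have h1 : ((p.1.support : Finset ℕ) : Set ℕ) ⊆ Set.range i.toEmbedding := by
        intro m hm
        have := Finsupp.mem_support_iff.1 (Finset.mem_coe.1 hm)
        exact hs m (by omega)
      have h2 : ((p.2.support : Finset ℕ) : Set ℕ) ⊆ Set.range i.toEmbedding := by
        intro m hm
        have := Finsupp.mem_support_iff.1 (Finset.mem_coe.1 hm)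
        exact hs m (by omega)
      have e1 := Finsupp.embDomain_comapDomain h1
      have e2 := Finsupp.embDomain_comapDomain h2
      refine ⟨(p.1.comapDomain i.toEmbedding i.toEmbedding.injective.injOn,
        p.2.comapDomain i.toEmbedding i.toEmbedding.injective.injOn), ?_, Prod.ext e1 e2⟩
      rw [Finset.HasAntidiagonal.mem_antidiagonal]
      apply Finsupp.embDomain_injective i.toEmbedding
      rw [Finsupp.embDomain_add]
      exact (congrArg₂ (· + ·) e1 e2).trans hp
    · intro d _
      rw [← Finset.map_sdiff]

theorem mul_mem_sQSym {f g : SuperSeries k} (hf : f ∈ sQSym k) (hg : g ∈ sQSym k) :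
    f * g ∈ sQSym k := by
  obtain ⟨⟨N, hN⟩, hf⟩ := hf
  obtain ⟨⟨N', hN'⟩, hg⟩ := hg
  constructor
  · refine ⟨N + N', fun m hm => ?_⟩
    rw [mul_apply] at hm
    obtain ⟨T, hT, hm⟩ := Finset.exists_ne_zero_of_sum_ne_zero hm
    obtain ⟨d, hd, hm⟩ := Finset.exists_ne_zero_of_sum_ne_zero hm
    have h1 := hN _ (right_ne_zero_of_mul (left_ne_zero_of_mul hm))
    have h2 := hN' _ (right_ne_zero_of_mul hm)
    rw [Finset.HasAntidiagonal.mem_antidiagonal] at hd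
    rw [Finset.mem_powerset] at hT
    have h3 := Finset.card_sdiff_add_card_eq_card hT
    have h4 : m.2.degree = d.1.degree + d.2.degree := by rw [← hd, map_add]
    simp only [SuperMonomial.degree] at *
    omega
  · intro α i j
    rw [mon_eq, mon_eq, mul_apply_map, mul_apply_map]
    refine Finset.sum_congr rfl fun T _ => Finset.sum_congr rfl fun d _ => ?_
    rw [thetaSign_map i j]
    refine congrArg₂ (· * ·) (congrArg₂ (· * ·) rfl ?_) ?_
    · exact hf.eq_of_shape (by rw [shape_map, shape_map])
    · exact hg.eq_of_shape (by rw [shape_map, shape_map])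

theorem one_mem_sQSym : (1 : SuperSeries k) ∈ sQSym k := by
  have h : (1 : SuperSeries k) = (M k []).1 := by
    classical
    funext m
    change (if m = (∅, 0) then (1 : k) else 0) = monomialSeries [] m
    refine if_congr ⟨?_, ?_⟩ rfl rfl
    · rintro rfl
      exact ⟨Fin.valOrderEmb 0, by simp [mon]⟩
    · rintro ⟨i, rfl⟩
      simp [mon]
  rw [h]
  exact (M k []).2

/-- The product of `sQSym` is the product of power series. -/
instance : Mul (sQSym k) where
  mul f g := ⟨f.1 * g.1, mul_mem_sQSym f.2 g.2⟩

instance : One (sQSym k) where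
  one := ⟨1, one_mem_sQSym⟩

/-- The homogeneous part of `sQSym` of degree `n` in `x` and `θ` together. -/
def gradeQ (n : ℕ) : Submodule k (sQSym k) where
  carrier := {f | ∀ m : SuperMonomial, f.1 m ≠ 0 → m.degree = n}
  zero_mem' := fun _ h => absurd rfl h
  add_mem' := by
    intro f g hf hg m hm
    by_cases h : f.1 m = 0
    · refine hg m fun h' => hm ?_
      change f.1 m + g.1 m = 0
      rw [h, h', add_zero]
    · exact hf m h
  smul_mem' := by
    intro c f hf m hm
    refine hf m fun h => hm ?_
    change c * f.1 m = 0
    rw [h, mul_zero]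

/-- The part of `sQSym` of parity `p`: the number of `θ`s in each monomial is `p` modulo `2`. -/
def parityQ (p : ZMod 2) : Submodule k (sQSym k) where
  carrier := {f | ∀ m : SuperMonomial, f.1 m ≠ 0 → (m.1.card : ZMod 2) = p}
  zero_mem' := fun _ h => absurd rfl h
  add_mem' := by
    intro f g hf hg m hm
    by_cases h : f.1 m = 0
    · refine hg m fun h' => hm ?_
      change f.1 m + g.1 m = 0
      rw [h, h', add_zero]
    · exact hf m h
  smul_mem' := by
    intro c f hf m hm
    refine hf m fun h => hm ?_
    change c * f.1 m = 0
    rw [h, mul_zero]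

/-- The comultiplication of `sQSym`:
`Δ(M_α) = ∑_{j = 0}^{l} M_{(α₁, …, α_j)} ⊗ M_{(α_{j+1}, …, α_l)}`. -/
def comulQ : sQSym k →ₗ[k] sQSym k ⊗[k] sQSym k :=
  (basisM k).constr k fun α =>
    ∑ j ∈ Finset.range (α.length + 1), M k (α.take j) ⊗ₜ[k] M k (α.drop j)

/-- The counit of `sQSym`: the constant term. -/
def counitQ : sQSym k →ₗ[k] k where
  toFun f := f.1 (∅, 0)
  map_add' _ _ := rfl
  map_smul' _ _ := rfl

/-- The supercharacter of `sQSym` given by the specialization `x₁ = 1`, `θ₁ = ε` and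
`x_i = θ_i = 0` for all the other `i`: only the monomials `x₁ ^ n` and `θ₁ x₁ ^ n` survive,
and there are finitely many of them in a series of finite degree. The algebra `k[ε]` is
`DualNumber k`; its even part is `k` and its odd part is `k ε`. -/
def zetaQ (f : sQSym k) : DualNumber k :=
  TrivSqZeroExt.inl (∑ᶠ n : ℕ, f.1 (∅, Finsupp.single 0 n)) +
    TrivSqZeroExt.inr (∑ᶠ n : ℕ, f.1 ({0}, Finsupp.single 0 n))

end SuperQSym

/-! ### Combinatorial Hopf superalgebras -/

namespace HopfSuper

variable {k A : Type*} [Field k] [Ring A] [Algebra k A]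

/-- The degree `n` part `⊕_{i + j = n} 𝒜 i ⊗ 𝒜 j` of `A ⊗ A`. -/
def tensorGrade {ι : Type*} [Add ι] (𝒜 : ι → Submodule k A) (n : ι) :
    Submodule k (A ⊗[k] A) :=
  ⨆ (i : ι) (j : ι) (_ : i + j = n), LinearMap.range (TensorProduct.mapIncl (𝒜 i) (𝒜 j))

/-- The algebra and coalgebra `A` is a Hopf superalgebra with parity `P`: the product, the unit,
the comultiplication and the counit are even, the comultiplication and the counit are algebra
morphisms, and there is an even antipode. The product of `A ⊗ A` is that of
`GradedTensorProduct`, `(a ⊗ b) (c ⊗ d) = (-1) ^ (|b| |c|) a c ⊗ b d`. -/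
structure IsHopfSuperalgebra [Coalgebra k A] (P : ZMod 2 → Submodule k A) [GradedAlgebra P] :
    Prop where
  comul_even : ∀ (p : ZMod 2), ∀ a ∈ P p, Coalgebra.comul (R := k) a ∈ tensorGrade P p
  counit_even : ∀ a ∈ P 1, Coalgebra.counit (R := k) a = 0
  comul_one : Coalgebra.comul (R := k) (1 : A) = 1 ⊗ₜ[k] 1
  comul_mul : ∀ a b : A,
    GradedTensorProduct.of k P P (Coalgebra.comul (R := k) (a * b)) =
      GradedTensorProduct.of k P P (Coalgebra.comul (R := k) a) *
        GradedTensorProduct.of k P P (Coalgebra.comul (R := k) b)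
  counit_one : Coalgebra.counit (R := k) (1 : A) = 1
  counit_mul : ∀ a b : A,
    Coalgebra.counit (R := k) (a * b) = Coalgebra.counit (R := k) a * Coalgebra.counit (R := k) b
  exists_antipode : ∃ S : A →ₗ[k] A, (∀ p, ∀ a ∈ P p, S a ∈ P p) ∧
    LinearMap.mul' k A ∘ₗ S.rTensor A ∘ₗ Coalgebra.comul =
      Algebra.linearMap k A ∘ₗ Coalgebra.counit ∧
    LinearMap.mul' k A ∘ₗ S.lTensor A ∘ₗ Coalgebra.comul =
      Algebra.linearMap k A ∘ₗ Coalgebra.counit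

/-- The projection `A → A^n` of a graded algebra `A = ⊕ A^n`. -/
def projGrade {ι : Type*} [DecidableEq ι] [AddMonoid ι] (𝒜 : ι → Submodule k A)
    [GradedAlgebra 𝒜] (n : ι) : A →ₗ[k] A :=
  (𝒜 n).subtype ∘ₗ DirectSum.component k ι (fun i => 𝒜 i) n ∘ₗ
    (DirectSum.decomposeLinearEquiv 𝒜).toLinearMap

/-- The Hopf superalgebra `A` with parity `P` is connected graded for the `ℕ`-grading `G`: each
`A^n` is the sum of its even and its odd part, the product, the unit, the comultiplication and the counit
(and hence the antipode) preserve the `ℕ`-grading, and `A^0 = k`. -/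
structure IsConnectedGraded [Coalgebra k A] (P : ZMod 2 → Submodule k A) [GradedAlgebra P]
    (G : ℕ → Submodule k A) [GradedAlgebra G] : Prop where
  parity : ∀ n, ∀ a ∈ G n, ∀ p, projGrade P p a ∈ G n
  comul_mem : ∀ n, ∀ a ∈ G n, Coalgebra.comul (R := k) a ∈ tensorGrade G n
  counit_eq_zero : ∀ n, n ≠ 0 → ∀ a ∈ G n, Coalgebra.counit (R := k) a = 0
  connected : G 0 = Submodule.span k {1}

/-- `ζ : A → k[ε]` is a supercharacter, i.e. an even algebra morphism. -/
structure IsSupercharacter (P : ZMod 2 → Submodule k A) (ζ : A →ₐ[k] DualNumber k) : Prop where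
  even : ∀ a ∈ P 0, (ζ a).snd = 0
  odd : ∀ a ∈ P 1, (ζ a).fst = 0

open SuperQSym

/-- `Ψ : A → sQSym` is a graded even morphism of Hopf superalgebras. (As for Hopf algebras,
it automatically commutes with the antipodes.) -/
structure IsGradedHopfMorphism [Coalgebra k A] (P : ZMod 2 → Submodule k A)
    (G : ℕ → Submodule k A) (Ψ : A →ₗ[k] sQSym k) : Prop where
  map_one : Ψ 1 = 1
  map_mul : ∀ a b, Ψ (a * b) = Ψ a * Ψ b
  map_comul : TensorProduct.map Ψ Ψ ∘ₗ Coalgebra.comul = comulQ ∘ₗ Ψ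
  map_counit : counitQ ∘ₗ Ψ = Coalgebra.counit
  map_parity : ∀ p, ∀ a ∈ P p, Ψ a ∈ parityQ p
  map_grade : ∀ n, ∀ a ∈ G n, Ψ a ∈ gradeQ n

/-- The isomorphism `A ⊗ A^{⊗ l} → A^{⊗ (l + 1)}`, as a linear map. -/
def consTensor (l : ℕ) : A ⊗[k] (⨂[k] _ : Fin l, A) →ₗ[k] ⨂[k] _ : Fin (l + 1), A :=
  TensorProduct.lift (PiTensorProduct.lift.toLinearMap ∘ₗ
    (PiTensorProduct.tprod k (s := fun _ : Fin (l + 1) => A)).curryLeft)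

/-- The iterated comultiplication `Δ^{(l - 1)} : A → A^{⊗ l}`. It is the counit for `l = 0`,
the identity for `l = 1`, and `Δ` for `l = 2`. -/
def iteratedComul [Coalgebra k A] : (l : ℕ) → A →ₗ[k] ⨂[k] _ : Fin l, A
  | 0 => (PiTensorProduct.isEmptyEquiv (Fin 0)).symm.toLinearMap ∘ₗ Coalgebra.counit
  | l + 1 => consTensor l ∘ₗ (iteratedComul l).lTensor A ∘ₗ Coalgebra.comul

/-- The projection of `A` onto the component attached to an entry: `A^n_0` for an entry `n`
and `A^{n + 1}_1` for an entry `ṅ`. -/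
def projPart (P : ZMod 2 → Submodule k A) [GradedAlgebra P] (G : ℕ → Submodule k A)
    [GradedAlgebra G] (p : DottedPart) : A →ₗ[k] A :=
  projGrade P (p.eta : ZMod 2) ∘ₗ projGrade G p.degree

/-- The scalar by which `ζ` acts on the component attached to an entry: the coefficient of
`1` in `ζ a` if the entry is not dotted, and the coefficient of `ε` if it is dotted. -/
def zetaPart (ζ : A →ₐ[k] DualNumber k) : DottedPart → A →ₗ[k] k
  | .plain _ => (TrivSqZeroExt.fstHom k k k).toLinearMap ∘ₗ ζ.toLinearMap
  | .dotted _ => TrivSqZeroExt.sndHom k k ∘ₗ ζ.toLinearMap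

/-- The functional `ζ_α = ζ^{⊗ l} ∘ π_α ∘ Δ^{(l - 1)}`. Since `ζ` is even, no signs occur in
`ζ^{⊗ l}`; on the component selected by `π_α` its values lie in
`k ε^{η₁} ⊗ ⋯ ⊗ k ε^{η_l}`, which is identified with `k`. -/
def zetaComp [Coalgebra k A] (P : ZMod 2 → Submodule k A) [GradedAlgebra P]
    (G : ℕ → Submodule k A) [GradedAlgebra G] (ζ : A →ₐ[k] DualNumber k)
    (α : DottedComposition) : A →ₗ[k] k :=
  PiTensorProduct.lift (MultilinearMap.mkPiAlgebra k (Fin α.length) k) ∘ₗ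
    PiTensorProduct.map (fun t => zetaPart ζ (α.get t)) ∘ₗ
      PiTensorProduct.map (fun t => projPart P G (α.get t)) ∘ₗ
        iteratedComul α.length

end HopfSuper

end

/-! ### Coordinates with respect to the basis `M` -/

namespace SuperQSym

variable {k : Type*} [Field k]

/-! Both families of functionals on `A`, namely `a ↦` (coefficient of `M α` in `Ψ a`) and `ζ_α`,
satisfy the same recursion on `α`, and they agree on compositions of length at most one. Since the
comultiplication of `sQSym` is deconcatenation, the coordinate at `p :: β` is the convolution of the
coordinates at `[p]` and at `β` (`coord_cons`). As `Ψ` is a coalgebra morphism, this passes to `A`,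
where `ζ_α` obeys the same rule because `iteratedComul` splits off one left factor at a time
(`zetaComp_cons`). Functionals are tensored without Koszul signs on both sides, so no signs have to
be compared. The empty composition gives the counit on both sides. For one entry
(`coeff_singleton_map`), the coordinate at `[p]` sees only one degree and one parity, and there it
is read off by `zetaQ`: in degree `n` the only monomials that survive the specialization are `x₁ ^
n` and `θ₁ x₁ ^ (n - 1)`. Then `zetaQ ∘ Ψ = ζ` concludes. -/

theorem basisM_coord_apply (α : DottedComposition) (f : sQSym k) :
    (basisM k).coord α f = coeff f.1 α := rfl

theorem coord_nil : (basisM k).coord [] = counitQ := by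
  refine LinearMap.ext fun f => ?_
  refine congrArg f.1 (Prod.ext ?_ ?_)
  · simp [mon]
  · simp [mon]

/-- Dual form of deconcatenation: a word can be cut into `[p]` and `β` only if it is `p :: β`, and
then in exactly one place. -/
theorem coord_cons (p : DottedPart) (β : DottedComposition) :
    (basisM k).coord (p :: β) =
      LinearMap.mul' k k ∘ₗ
        TensorProduct.map ((basisM k).coord [p]) ((basisM k).coord β) ∘ₗ comulQ := by
  classical
  refine (basisM k).ext fun γ => ?_
  have hc : ∀ α δ : DottedComposition,
      (basisM k).coord α (M k δ) = if δ = α then 1 else 0 := by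
    intro α δ
    rw [← basisM_apply, Module.Basis.coord_apply, Module.Basis.repr_self, Finsupp.single_apply]
  rw [LinearMap.comp_apply, LinearMap.comp_apply, comulQ, Module.Basis.constr_basis,
    basisM_apply, hc]
  simp only [map_sum, TensorProduct.map_tmul, LinearMap.mul'_apply, hc]
  cases γ with
  | nil => simp
  | cons q γ =>
    -- Only the cut after the first entry leaves a prefix of length one. For `j` in the range of
    -- summation, `take j` has length exactly `j`.
    rw [Finset.sum_eq_single 1]
    · by_cases h1 : q = p <;> by_cases h2 : γ = β <;> simp [h1, h2]
    · intro j hj hj1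
      rw [Finset.mem_range] at hj
      have : (q :: γ).take j ≠ [p] := by
        intro h
        have := congrArg List.length h
        simp only [List.length_take, List.length_cons, List.length_nil] at this hj
        omega
      rw [if_neg this, zero_mul]
    · intro h
      simp at h

theorem coeff_eq_zero_of_mem_gradeQ {n : ℕ} {f : sQSym k} (hf : f ∈ gradeQ n)
    {α : DottedComposition} (hα : compDegree α ≠ n) : coeff f.1 α = 0 := by
  by_contra h
  exact hα ((degree_mon _ _).symm.trans (hf _ h))

/-- The representative monomial chosen by `coeff` uses the first variables, those of index `0`. It
is therefore one of the monomials that `zetaQ` does not kill; likewise for `mon_dotted`. -/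
theorem mon_plain (n : ℕ+) :
    mon [.plain n] (Fin.valOrderEmb 1) = (∅, Finsupp.single 0 (n : ℕ)) := by
  refine Prod.ext ?_ ?_
  · simp [mon, DottedPart.eta]
  · simp [mon, DottedPart.val]

theorem mon_dotted (n : ℕ) :
    mon [.dotted n] (Fin.valOrderEmb 1) = ({0}, Finsupp.single 0 n) := by
  refine Prod.ext ?_ ?_
  · ext i
    simp [mon, DottedPart.eta]
  · simp [mon, DottedPart.val]

theorem coeff_singleton_eq_zero_of_mem_parityQ {q : ZMod 2} {f : sQSym k} (hf : f ∈ parityQ q)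
    {p : DottedPart} (hp : (p.eta : ZMod 2) ≠ q) : coeff f.1 [p] = 0 := by
  by_contra h
  refine hp (Eq.trans ?_ (hf _ h))
  cases p with
  | plain n =>
    change _ = (((mon [.plain n] (Fin.valOrderEmb 1)).1.card : ℕ) : ZMod 2)
    rw [mon_plain]; rfl
  | dotted n =>
    change _ = (((mon [.dotted n] (Fin.valOrderEmb 1)).1.card : ℕ) : ZMod 2)
    rw [mon_dotted]; rfl

/-- Homogeneity reduces the sum over all powers of `x₁` to the single exponent `n`. -/
theorem fst_zetaQ (n : ℕ+) {f : sQSym k} (hf : f ∈ gradeQ (n : ℕ)) :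
    (zetaQ f).fst = coeff f.1 [.plain n] := by
  have h : (zetaQ f).fst = ∑ᶠ m : ℕ, f.1 (∅, Finsupp.single 0 m) := by simp [zetaQ]
  rw [h, finsum_eq_single _ (n : ℕ)]
  · rw [← mon_plain]; rfl
  · intro m hm
    by_contra h0
    exact hm (by simpa [SuperMonomial.degree] using hf _ h0)

/-- Here `θ₁` accounts for one unit of the degree `n + 1`, so the surviving exponent of `x₁` is `n`.
-/
theorem snd_zetaQ (n : ℕ) {f : sQSym k} (hf : f ∈ gradeQ (n + 1)) :
    (zetaQ f).snd = coeff f.1 [.dotted n] := by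
  have h : (zetaQ f).snd = ∑ᶠ m : ℕ, f.1 ({0}, Finsupp.single 0 m) := by simp [zetaQ]
  rw [h, finsum_eq_single _ n]
  · rw [← mon_dotted]; rfl
  · intro m hm
    by_contra h0
    exact hm (by simpa [SuperMonomial.degree] using hf _ h0)

theorem eq_sum_coeff_smul_M {n : ℕ} {f : sQSym k} (hf : f ∈ gradeQ n) :
    f = ∑ α ∈ dottedCompositions n, coeff f.1 α • M k α := by
  conv_lhs => rw [← (basisM k).linearCombination_repr f, Finsupp.linearCombination_apply]
  rw [Finsupp.sum_of_support_subset (s := dottedCompositions n)]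
  · exact Finset.sum_congr rfl fun α _ => by rw [basisM_apply]; rfl
  · intro α hα
    rw [mem_dottedCompositions]
    by_contra h
    exact Finsupp.mem_support_iff.1 hα (coeff_eq_zero_of_mem_gradeQ hf h)
  · intro α _
    exact zero_smul _ _

end SuperQSym

/-! ### The functionals `ζ_α` and their comparison with the coordinates of `Ψ` -/

namespace HopfSuper

open SuperQSym

variable {k A : Type*} [Field k] [Ring A] [Algebra k A]

theorem projGrade_mem {ι : Type*} [DecidableEq ι] [AddMonoid ι] (𝒜 : ι → Submodule k A)
    [GradedAlgebra 𝒜] (n : ι) (a : A) : projGrade 𝒜 n a ∈ 𝒜 n :=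
  Subtype.property _

/-- A linear map that kills all components but the `n`-th factors through the `n`-th projection. -/
theorem apply_projGrade {ι V : Type*} [DecidableEq ι] [AddMonoid ι] [AddCommGroup V] [Module k V]
    (𝒜 : ι → Submodule k A) [GradedAlgebra 𝒜] (n : ι) (φ : A →ₗ[k] V)
    (hφ : ∀ m, m ≠ n → ∀ a ∈ 𝒜 m, φ a = 0) (a : A) : φ (projGrade 𝒜 n a) = φ a := by
  classical
  have h : projGrade 𝒜 n a = (DirectSum.decompose 𝒜 a n : A) := rfl
  conv_rhs => rw [← DirectSum.sum_support_decompose 𝒜 a, map_sum]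
  rw [h]
  symm
  refine Finset.sum_eq_single n (fun m _ hm => hφ m hm _ (Subtype.property _)) fun hn => ?_
  rw [DFinsupp.notMem_support_iff.1 hn]
  simp

theorem consTensor_tmul_tprod (l : ℕ) (a : A) (v : Fin l → A) :
    consTensor (k := k) l (a ⊗ₜ[k] PiTensorProduct.tprod k v) =
      PiTensorProduct.tprod k (Fin.cons a v : Fin (l + 1) → A) := by
  simp [consTensor]

/-- On pure tensors this is the splitting of the factor at `0` from a product over `Fin (l + 1)`. -/
theorem lift_map_map_comp_consTensor {l : ℕ} (f : Fin (l + 1) → A →ₗ[k] k)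
    (g : Fin (l + 1) → A →ₗ[k] A) :
    PiTensorProduct.lift (MultilinearMap.mkPiAlgebra k (Fin (l + 1)) k) ∘ₗ
        PiTensorProduct.map f ∘ₗ PiTensorProduct.map g ∘ₗ consTensor l =
      LinearMap.mul' k k ∘ₗ
        TensorProduct.map (f 0 ∘ₗ g 0)
          (PiTensorProduct.lift (MultilinearMap.mkPiAlgebra k (Fin l) k) ∘ₗ
            PiTensorProduct.map (fun t => f t.succ) ∘ₗ
              PiTensorProduct.map (fun t => g t.succ)) := by
  refine TensorProduct.ext (LinearMap.ext fun a => PiTensorProduct.ext ?_)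
  refine MultilinearMap.ext fun v => ?_
  change PiTensorProduct.lift (MultilinearMap.mkPiAlgebra k (Fin (l + 1)) k)
      (PiTensorProduct.map f (PiTensorProduct.map g
        (consTensor l (a ⊗ₜ[k] PiTensorProduct.tprod k v)))) =
    f 0 (g 0 a) * PiTensorProduct.lift (MultilinearMap.mkPiAlgebra k (Fin l) k)
      (PiTensorProduct.map (fun t => f t.succ) (PiTensorProduct.map (fun t => g t.succ)
        (PiTensorProduct.tprod k v)))
  simp only [consTensor_tmul_tprod, PiTensorProduct.map_tprod, PiTensorProduct.lift.tprod,
    MultilinearMap.mkPiAlgebra_apply, Fin.prod_univ_succ, Fin.cons_zero, Fin.cons_succ]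

variable [Coalgebra k A]

theorem zetaComp_nil (P : ZMod 2 → Submodule k A) [GradedAlgebra P] (G : ℕ → Submodule k A)
    [GradedAlgebra G] (ζ : A →ₐ[k] DualNumber k) :
    zetaComp P G ζ [] = Coalgebra.counit := by
  refine LinearMap.ext fun a => ?_
  simp [zetaComp, iteratedComul]

/-- The counterpart of `coord_cons`. `iteratedComul` iterates in the right tensor factor, the side
on which `β` stands, so coassociativity is not needed. -/
theorem zetaComp_cons (P : ZMod 2 → Submodule k A) [GradedAlgebra P] (G : ℕ → Submodule k A)
    [GradedAlgebra G] (ζ : A →ₐ[k] DualNumber k) (p : DottedPart) (β : DottedComposition) :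
    zetaComp P G ζ (p :: β) =
      LinearMap.mul' k k ∘ₗ
        TensorProduct.map (zetaPart ζ p ∘ₗ projPart P G p) (zetaComp P G ζ β) ∘ₗ
          Coalgebra.comul := by
  have h := lift_map_map_comp_consTensor (fun t => zetaPart ζ ((p :: β).get t))
    (fun t => projPart P G ((p :: β).get t))
  refine LinearMap.ext fun a => (LinearMap.congr_fun h
    ((iteratedComul (k := k) (A := A) β.length).lTensor A (Coalgebra.comul (R := k) a))).trans ?_
  refine congrArg (LinearMap.mul' k k) ?_
  -- Functoriality absorbs the remaining iterated comultiplication into the second factor, which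
  -- becomes `zetaComp P G ζ β`.
  rw [LinearMap.lTensor, ← LinearMap.comp_apply (TensorProduct.map _ _), ← TensorProduct.map_comp]
  rfl

/-- The only place where the compatibility of `Ψ` with the characters enters. -/
theorem coeff_singleton_map (P : ZMod 2 → Submodule k A) [GradedAlgebra P]
    (G : ℕ → Submodule k A) [GradedAlgebra G] (hG : IsConnectedGraded P G)
    (ζ : A →ₐ[k] DualNumber k) (Ψ : A →ₗ[k] sQSym k) (hΨ : IsGradedHopfMorphism P G Ψ)
    (hΨζ : ∀ a, zetaQ (Ψ a) = ζ a) (p : DottedPart) :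
    (basisM k).coord [p] ∘ₗ Ψ = zetaPart ζ p ∘ₗ projPart P G p := by
  refine LinearMap.ext fun a => ?_
  have hdeg : compDegree [p] = p.degree := by simp [compDegree]
  -- As `Ψ` preserves parity and degree, the coordinate at `[p]` vanishes on every other parity and
  -- every other degree, so each of the two projections can be dropped.
  have hproj : ((basisM k).coord [p] ∘ₗ Ψ) (projPart P G p a) = ((basisM k).coord [p] ∘ₗ Ψ) a := by
    refine (apply_projGrade P _ _ (fun q hq b hb => ?_) _).trans
      (apply_projGrade G _ _ (fun n hn b hb => ?_) a)
    · exact coeff_singleton_eq_zero_of_mem_parityQ (hΨ.map_parity q b hb) hq.symm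
    · exact coeff_eq_zero_of_mem_gradeQ (hΨ.map_grade n b hb) (hdeg ▸ hn.symm)
  rw [← hproj, LinearMap.comp_apply, LinearMap.comp_apply, basisM_coord_apply]
  -- The parity projection, applied last, keeps the element in its degree because each `G n` is
  -- stable under it. From here on only the degree matters.
  have hb : Ψ (projPart P G p a) ∈ gradeQ p.degree :=
    hΨ.map_grade _ _ (hG.parity _ _ (projGrade_mem G _ a) _)
  generalize projPart P G p a = b at hb
  cases p with
  | plain n =>
    rw [← fst_zetaQ n hb, hΨζ]
    rfl
  | dotted n =>
    rw [← snd_zetaQ n hb, hΨζ]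
    rfl

/-- The coefficient of `M_α` in `Ψ a` is `ζ_α a`, for all `a`, homogeneous or not. -/
theorem coord_comp_eq_zetaComp (P : ZMod 2 → Submodule k A) [GradedAlgebra P]
    (G : ℕ → Submodule k A) [GradedAlgebra G] (hG : IsConnectedGraded P G)
    (ζ : A →ₐ[k] DualNumber k) (Ψ : A →ₗ[k] sQSym k) (hΨ : IsGradedHopfMorphism P G Ψ)
    (hΨζ : ∀ a, zetaQ (Ψ a) = ζ a) (α : DottedComposition) :
    (basisM k).coord α ∘ₗ Ψ = zetaComp P G ζ α := by
  induction α with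
  | nil => rw [coord_nil, hΨ.map_counit, zetaComp_nil]
  | cons p β ih =>
    -- Both functionals on the right now end in `Ψ`; pulling out `Ψ ⊗ Ψ` and using that `Ψ` respects
    -- the comultiplications identifies the two recursions.
    rw [coord_cons, zetaComp_cons, ← ih, ← coeff_singleton_map P G hG ζ Ψ hΨ hΨζ p,
      TensorProduct.map_comp, LinearMap.comp_assoc, LinearMap.comp_assoc, ← hΨ.map_comul,
      LinearMap.comp_assoc]

end HopfSuper

theorem proposition4p3 {k A : Type*} [Field k] [CharZero k] [Ring A] [Algebra k A] [Coalgebra k A]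
    (P : ZMod 2 → Submodule k A) [GradedAlgebra P] (G : ℕ → Submodule k A) [GradedAlgebra G]
    (hA : HopfSuper.IsHopfSuperalgebra P) (hG : HopfSuper.IsConnectedGraded P G)
    (ζ : A →ₐ[k] DualNumber k) (hζ : HopfSuper.IsSupercharacter P ζ)
    (Ψ : A →ₗ[k] SuperQSym.sQSym k) (hΨ : HopfSuper.IsGradedHopfMorphism P G Ψ)
    (hΨζ : ∀ a, SuperQSym.zetaQ (Ψ a) = ζ a)
    (n : ℕ) (a : A) (ha : a ∈ G n) :
    Ψ a = ∑ α ∈ SuperQSym.dottedCompositions n,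
      HopfSuper.zetaComp P G ζ α a • SuperQSym.M k α := by

  -- Homogeneity of `a` serves to confine the basis expansion of `Ψ a` to the dotted compositions of
  -- `n`.
  refine (SuperQSym.eq_sum_coeff_smul_M (hΨ.map_grade n a ha)).trans
    (Finset.sum_congr rfl fun α _ => congrArg (· • SuperQSym.M k α) ?_)
  exact LinearMap.congr_fun (HopfSuper.coord_comp_eq_zetaComp P G hG ζ Ψ hΨ hΨζ α) a
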